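/- Let $\mathbf F=abaababa\cdots$ be the Fibonacci word, the infinite word generated by the substitution $a\mapsto ab$, $b\mapsto a$, and let $F_0=0$, $F_1=1$, $F_2=1,\dots$ be the Fibonacci numbers. The upper Wythoff numbers $2,5,7,10,13,\dots$ are the positions of the letter $b$ in $\mathbf F$, with positions counted from $1$. An unsum is a positive integer that is not the sum of two distinct upper Wythoff numbers (A260317). There are infinitely many unsums; let $u_1<u_2<\cdots$ be all of them, and consider the sequence of gaps $u_{k+1}-u_k$, $k\ge 1$ (A260311), as an infinite word of digits. There are finite words $W_1,W_2,W_3,\dots$, all of whose letters are $3$ or $5$, such that the gap sequence is $$1111122121\;2W_1\,2W_1\,2W_2\,2W_2\,2W_3\,2W_3\cdots,$$ that is, the prefix $1111122121$ followed by the concatenation over $i=1,2,3,\dots$ of $2W_i2W_i$. (The $W_i$ are thus the words between consecutive entries $2$ after the prefix.) They satisfy: 1. For every $i\ge 1$, the word $W_i$ is a palindrome of length $F_{i+1}$. 2. For every $i\ge1$, the sum of the digits of $W_i$ plus $2$ equals $F_{i+4}$. 3. $W_1=3$, $W_2=33$, $W_3=353$, and for every $n\ge 3$ the words $W_{n+1}$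 and $W_n$ agree in their first $\lceil |W_{n+1}|/2\rceil$ letters. 4. The words $W_n$ converge, letter by letter, to the infinite word $3\mathbf F$, where $a$ is replaced by $5$ and $b$ by $3$ in $\mathbf F$: for every position $j$, the $j$-th letter of $W_n$ exists and equals the $j$-th letter of $3\mathbf F$ for all sufficiently large $n$. -/

import Mathlib

namespace WythoffUnsums

/-- The alphabet of the Fibonacci word. -/
inductive Letter
  | a
  | b
  deriving DecidableEq

/-- The images of the letters under the substitution `a ↦ ab`, `b ↦ a`. -/
def Letter.subst : Letter → List Letter
  | .a => [.a, .b]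
  | .b => [.a]

/-- The substitution `a ↦ ab`, `b ↦ a`, applied to a finite word. -/
def substWord (w : List Letter) : List Letter := w.flatMap Letter.subst

/-- The `n`-th iterate of the substitution on the one-letter word `a`:
`a, ab, aba, abaab, …`. -/
def fibPrefix (n : ℕ) : List Letter := substWord^[n] [Letter.a]

theorem substWord_append (v w : List Letter) :
    substWord (v ++ w) = substWord v ++ substWord w := by
  simp [substWord]

theorem fibPrefix_succ (n : ℕ) : fibPrefix (n + 1) = substWord (fibPrefix n) := by
  simp only [fibPrefix, Function.iterate_succ_apply']

theorem fibPrefix_rec (n : ℕ) :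
    fibPrefix (n + 2) = fibPrefix (n + 1) ++ fibPrefix n := by
  induction n with
  | zero => rfl
  | succ n ih =>
    rw [fibPrefix_succ (n + 1 + 1), ih, substWord_append, ← fibPrefix_succ, ← fibPrefix_succ, ← ih]

theorem fibPrefix_length (n : ℕ) : (fibPrefix n).length = Nat.fib (n + 2) := by
  induction n using Nat.twoStepInduction with
  | zero => rfl
  | one => rfl
  | more n ih1 ih2 =>
    rw [fibPrefix_rec, List.length_append, ih1, ih2, Nat.fib_add_two (n := n + 2), add_comm]

theorem fibPrefix_prefix_succ (n : ℕ) : fibPrefix n <+: fibPrefix (n + 1) := by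
  cases n with
  | zero => exact ⟨[Letter.b], rfl⟩
  | succ n => exact ⟨fibPrefix n, (fibPrefix_rec n).symm⟩

theorem fibPrefix_prefix {m n : ℕ} (h : m ≤ n) : fibPrefix m <+: fibPrefix n := by
  induction n, h using Nat.le_induction with
  | base => exact List.prefix_rfl
  | succ n _ ih => exact ih.trans (fibPrefix_prefix_succ n)

theorem lt_fibPrefix_length (j : ℕ) : j < (fibPrefix j).length := by
  induction j using Nat.twoStepInduction with
  | zero => decide
  | one => decide
  | more n ih1 ih2 =>
    rw [fibPrefix_rec, List.length_append]
    omega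

/-- The Fibonacci word `abaababaabaab⋯`, the infinite word generated by the substitution
`a ↦ ab`, `b ↦ a`, with positions counted from `0`. -/
def fibWord (j : ℕ) : Letter := (fibPrefix j)[j]'(lt_fibPrefix_length j)

/-- Every iterate `fibPrefix n` is a prefix of the Fibonacci word. -/
theorem fibWord_eq {n j : ℕ} (h : j < (fibPrefix n).length) :
    (fibPrefix n)[j] = fibWord j := by
  unfold fibWord
  rcases le_total n j with hn | hn
  · exact (fibPrefix_prefix hn).getElem h
  · exact ((fibPrefix_prefix hn).getElem (lt_fibPrefix_length j)).symm

/-- Upper Wythoff numbers: the positions of the letter `b` in the Fibonacci word, with positions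
counted from `1`. -/
def IsUpperWythoff (m : ℕ) : Prop := ∃ j : ℕ, fibWord j = Letter.b ∧ m = j + 1

/-- Unsums: the positive integers that are not the sum of two distinct upper Wythoff numbers. -/
def IsUnsum (n : ℕ) : Prop :=
  0 < n ∧ ¬ ∃ u v : ℕ, IsUpperWythoff u ∧ IsUpperWythoff v ∧ u < v ∧ n = u + v

/-- The increasing enumeration of the unsums, starting at index `0`. -/
noncomputable def unsum (k : ℕ) : ℕ := Nat.nth IsUnsum k

/-- The gaps between consecutive unsums, starting at index `0`. -/
noncomputable def gap (k : ℕ) : ℕ := unsum (k + 1) - unsum k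

/-- The irregular initial word `1111122121`. -/
def irregular : List ℕ := [1, 1, 1, 1, 1, 2, 2, 1, 2, 1]

/-- The word `2 W₁ 2 W₁ 2 W₂ 2 W₂ ⋯ 2 Wₙ 2 Wₙ`. -/
def doubled (W : ℕ → List ℕ) : ℕ → List ℕ
  | 0 => []
  | n + 1 => doubled W n ++ ([2] ++ W (n + 1) ++ [2] ++ W (n + 1))

/-- The finite word `w` is an initial segment of the infinite word `s`. -/
def IsInitialWord (w : List ℕ) (s : ℕ → ℕ) : Prop :=
  w = (List.range w.length).map s

/-- The coding `a ↦ 5`, `b ↦ 3`. -/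
def Letter.digit : Letter → ℕ
  | .a => 5
  | .b => 3

/-- The infinite word `3F`, where `F` is the Fibonacci word with `a ↦ 5`, `b ↦ 3`. -/
def threeFib : ℕ → ℕ
  | 0 => 3
  | j + 1 => (fibWord j).digit

/-- Convergence of finite words to an infinite word: each letter of the infinite word is the letter
at that position of all but finitely many of the finite words. -/
def WordsTendsto (W : ℕ → List ℕ) (s : ℕ → ℕ) : Prop :=
  ∀ j : ℕ, ∀ᶠ n in Filter.atTop, (W n)[j]? = some (s j)

end WythoffUnsums

/-!
The upper Wythoff numbers are `upper k = ⌊k φ²⌋ = lower k + k` with `lower k = ⌊k φ⌋`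
(`isUpperWythoff_iff`): the Fibonacci word is the difference word of `lower`, because adding a
Fibonacci number `F_{m+1}` to a smaller index adds `F_{m+2}` to `lower` (`lower_add_fib`).

A sum `upper i + upper j` is `upper (i + j)` or one less, depending on whether the fractional parts
of `i φ` and `j φ` carry. So a number `x` for which neither `x` nor `x + 1` is an upper Wythoff
number, in other words a position of the factor `aa` of the Fibonacci word, is an unsum. All other
unsums, called exceptional, come from an `s` such that the sums of two distinct indices with value
`s` always carry or never carry. This means that the fractional part of `s φ` is a record minimum or
maximum if the index `s / 2` is disregarded. Since Fibonacci numbers are the denominators of the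
best approximations to `φ` (`inv_goldenRatio_pow_le_abs`), it happens precisely for `s = F_k` and
`s = 2 F_k`, the parity of `k` deciding between minimum and maximum (`fract_record_iff`). The
exceptional unsums above `5` are therefore `F_k` and `2 F_k` for odd `k`, and `F_k - 2` and
`2 F_k - 2` for even `k` (`isExceptional_iff`).

The return words of `aa` have lengths `5` and `3`, and the coding by them is conjugate to the third
power of the substitution. Hence the gaps between the positions of `aa` form the Fibonacci word
itself (`gapsFrom_isDoubleA`). An exceptional unsum splits a gap `5` into `2, 3` or `3, 2`. The
factor of the Fibonacci word between the ends of two squares `fₙ₊₂fₙ₊₂` and `fₙ₊₄fₙ₊₄` of its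
standard prefixes, shifted by one letter, is built from central words, that is, from prefixes `fₘ`
without their last two letters (`fibPrefix_square`). For even `n` the corresponding interval
contains exactly four exceptional unsums, and splitting there turns the gaps into
`2 W 2 W 2 W' 2 W'`, where `W` and `W'` are consecutive central words between two digits `3`
(`gapsFrom_isUnsum_block`). The remaining properties of the words `W` are those of central words,
which are palindromes and prefixes of the Fibonacci word.
-/

namespace WythoffUnsums

open scoped goldenRatio

theorem inv_goldenRatio_pos : 0 < φ⁻¹ := inv_pos.mpr Real.goldenRatio_pos

theorem inv_goldenRatio_lt_one : φ⁻¹ < 1 := inv_lt_one_of_one_lt₀ Real.one_lt_goldenRatio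

theorem inv_goldenRatio_sq : φ⁻¹ ^ 2 = 1 - φ⁻¹ := by
  rw [Real.inv_goldenRatio]
  linarith [Real.goldenConj_sq, neg_sq ψ]

theorem half_lt_inv_goldenRatio : 1 / 2 < φ⁻¹ := by
  rw [one_div]
  exact inv_strictAnti₀ Real.goldenRatio_pos Real.goldenRatio_lt_two

theorem inv_goldenRatio_pow_lt_one {k : ℕ} (hk : 0 < k) : φ⁻¹ ^ k < 1 :=
  pow_lt_one₀ inv_goldenRatio_pos.le inv_goldenRatio_lt_one hk.ne'

theorem inv_goldenRatio_pow_succ_lt (k : ℕ) : φ⁻¹ ^ (k + 1) < φ⁻¹ ^ k :=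
  pow_lt_pow_right_of_lt_one₀ inv_goldenRatio_pos inv_goldenRatio_lt_one k.lt_succ_self

theorem two_mul_inv_goldenRatio_pow_lt_one {k : ℕ} (hk : 2 ≤ k) : 2 * φ⁻¹ ^ k < 1 := by
  have h1 : φ⁻¹ ^ k ≤ φ⁻¹ ^ 2 :=
    pow_le_pow_of_le_one inv_goldenRatio_pos.le inv_goldenRatio_lt_one.le hk
  have h2 := inv_goldenRatio_sq
  have h3 := half_lt_inv_goldenRatio
  linarith

/-! ### Fibonacci numbers as best denominators for the golden ratio -/

theorem fib_mul_goldenRatio (k : ℕ) : (Nat.fib k : ℝ) * φ = Nat.fib (k + 1) - ψ ^ k := by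
  linarith [Real.fib_succ_sub_goldenRatio_mul_fib k, mul_comm φ (Nat.fib k : ℝ)]

theorem goldenConj_pow_of_even {k : ℕ} (hk : Even k) : ψ ^ k = φ⁻¹ ^ k := by
  rw [Real.inv_goldenRatio, hk.neg_pow]

theorem goldenConj_pow_of_odd {k : ℕ} (hk : Odd k) : ψ ^ k = -φ⁻¹ ^ k := by
  rw [Real.inv_goldenRatio, hk.neg_pow, neg_neg]

theorem abs_goldenConj_pow (k : ℕ) : |ψ ^ k| = φ⁻¹ ^ k := by
  rw [abs_pow, abs_of_neg Real.goldenConj_neg, Real.inv_goldenRatio]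

/-- Two consecutive vectors `(F_k, F_{k+1})` and `(F_{k+1}, F_{k+2})` generate the lattice `ℤ²`. -/
theorem exists_fib_coordinates (k : ℕ) (m p : ℤ) : ∃ x y : ℤ,
    m = x * Nat.fib k + y * Nat.fib (k + 1) ∧
      p = x * Nat.fib (k + 1) + y * Nat.fib (k + 2) := by
  induction k with
  | zero => exact ⟨p - m, m, by simp, by simp⟩
  | succ k ih =>
    obtain ⟨x, y, h1, h2⟩ := ih
    refine ⟨y - x, x, ?_, ?_⟩
    · rw [h1, Nat.fib_add_two (n := k)]; push_cast; ring
    · rw [h2, Nat.fib_add_two (n := k + 1)]; push_cast; ring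

/-- The Fibonacci numbers are the denominators of the best approximations to the golden ratio. -/
theorem inv_goldenRatio_pow_le_abs {k m : ℕ} (hm : 0 < m) (hmk : m < Nat.fib (k + 1)) (p : ℤ) :
    φ⁻¹ ^ k ≤ |(m : ℝ) * φ - p| := by
  obtain ⟨x, y, h1, h2⟩ := exists_fib_coordinates k m p
  have hf0 : (0 : ℤ) ≤ Nat.fib k := by positivity
  have hm' : (0 : ℤ) < m := by exact_mod_cast hm
  have hmk' : (m : ℤ) < Nat.fib (k + 1) := by exact_mod_cast hmk
  -- The coordinates have opposite signs and the first one does not vanish.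
  have hxy : (1 ≤ x ∧ y ≤ 0) ∨ (x ≤ -1 ∧ 0 ≤ y) := by
    rcases lt_trichotomy x 0 with hx | hx | hx
    · exact .inr ⟨by omega, by by_contra! hy; nlinarith⟩
    · subst hx
      rcases lt_or_ge 0 y with hy | hy <;> nlinarith
    · exact .inl ⟨by omega, by by_contra! hy; nlinarith⟩
  have key : (m : ℝ) * φ - p = -(ψ ^ k * (x + y * ψ)) := by
    have e1 : (m : ℝ) = x * Nat.fib k + y * Nat.fib (k + 1) := by exact_mod_cast h1
    have e2 : (p : ℝ) = x * Nat.fib (k + 1) + y * Nat.fib (k + 2) := by exact_mod_cast h2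
    have e3 := fib_mul_goldenRatio k
    have e4 := fib_mul_goldenRatio (k + 1)
    rw [e1, e2]
    linear_combination (x : ℝ) * e3 + (y : ℝ) * e4
  rw [key, abs_neg, abs_mul, abs_goldenConj_pow]
  refine le_mul_of_one_le_right (pow_nonneg inv_goldenRatio_pos.le k) ?_
  have hψ := Real.goldenConj_neg
  rcases hxy with ⟨hx, hy⟩ | ⟨hx, hy⟩
  · have hx' : (1 : ℝ) ≤ x := by exact_mod_cast hx
    have hy' : (y : ℝ) ≤ 0 := by exact_mod_cast hy
    exact le_trans (by nlinarith) (le_abs_self _)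
  · have hx' : (x : ℝ) ≤ -1 := by exact_mod_cast hx
    have hy' : (0 : ℝ) ≤ y := by exact_mod_cast hy
    exact le_trans (by nlinarith) (neg_le_abs _)

theorem exists_fib_le_lt (r : ℕ) (hr : r = 1 ∨ r = 2) {s : ℕ} (hs : 0 < s) :
    ∃ j : ℕ, Nat.fib (2 * j + r) ≤ s ∧ s < Nat.fib (2 * j + r + 2) := by
  have hex : ∃ j : ℕ, s < Nat.fib (2 * j + r + 2) :=
    ⟨s, by have := Nat.le_fib_add_one (2 * s + r + 2); omega⟩
  refine ⟨Nat.find hex, ?_, Nat.find_spec hex⟩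
  rcases h : Nat.find hex with _ | j
  · rcases hr with rfl | rfl <;> simpa using Nat.succ_le_of_lt hs
  · have := Nat.find_min hex (m := j) (by omega)
    have e : 2 * (j + 1) + r = 2 * j + r + 2 := by ring
    rw [e]
    omega

/-- The integers `s` at which the fractional part of `s * α`, for `α = ±φ`, is smaller than at
every smaller positive integer, except possibly at `s / 2`: they are `F_k` and `2 * F_k`, where `k`
runs through the indices of one parity. -/
theorem fract_record_iff {α : ℝ} (hα : α = φ ∨ α = -φ) {r : ℕ} (hr : r = 1 ∨ r = 2)
    (hfib : ∀ j : ℕ, ∃ z : ℤ, (Nat.fib (2 * j + r) : ℝ) * α = z + φ⁻¹ ^ (2 * j + r))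
    {s : ℕ} (hs : 0 < s) :
    (∀ i : ℕ, 0 < i → i < s → 2 * i ≠ s → Int.fract ((s : ℝ) * α) < Int.fract ((i : ℝ) * α)) ↔
      ∃ j : ℕ, s = Nat.fib (2 * j + r) ∨ s = 2 * Nat.fib (2 * j + r) := by
  have best : ∀ k m : ℕ, 0 < m → m < Nat.fib (k + 1) → ∀ p : ℤ,
      φ⁻¹ ^ k ≤ |(m : ℝ) * α - p| := by
    intro k m hm hmk p
    rcases hα with rfl | rfl
    · exact inv_goldenRatio_pow_le_abs hm hmk p
    · have := inv_goldenRatio_pow_le_abs hm hmk (-p)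
      rwa [← abs_neg, show -((m : ℝ) * -φ - p) = (m : ℝ) * φ - ((-p : ℤ) : ℝ) by push_cast; ring]
  have hfract : ∀ j : ℕ, Int.fract ((Nat.fib (2 * j + r) : ℝ) * α) = φ⁻¹ ^ (2 * j + r) := by
    intro j
    obtain ⟨z, hz⟩ := hfib j
    rw [hz, Int.fract_intCast_add, Int.fract_eq_self]
    exact ⟨pow_nonneg inv_goldenRatio_pos.le _, inv_goldenRatio_pow_lt_one (by omega)⟩
  constructor
  · intro H
    obtain ⟨j, hj1, hj2⟩ := exists_fib_le_lt r hr hs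
    refine ⟨j, ?_⟩
    by_contra! hne
    have hpos : 0 < Nat.fib (2 * j + r) := Nat.fib_pos.2 (by omega)
    have h1 := H _ hpos (by omega) (by omega)
    rw [hfract] at h1
    obtain ⟨z, hz⟩ := hfib j
    rw [Nat.fib_add_two] at hj2
    have h2 := best (2 * j + r) (s - Nat.fib (2 * j + r)) (by omega) (by omega)
      (⌊(s : ℝ) * α⌋ - z)
    have h3 : ((s - Nat.fib (2 * j + r) : ℕ) : ℝ) * α - ((⌊(s : ℝ) * α⌋ - z : ℤ) : ℝ) =
        Int.fract ((s : ℝ) * α) - φ⁻¹ ^ (2 * j + r) := by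
      rw [Nat.cast_sub hj1, Int.fract]
      push_cast
      linear_combination -hz
    rw [h3] at h2
    -- As `s` is not a multiple of a number of the list, its fractional part is positive.
    have h4 := best (s + 1) s hs (by
      have : s + 2 ≤ Nat.fib (s + 1 + 1) + 1 := Nat.le_fib_add_one (s + 2)
      omega) ⌊(s : ℝ) * α⌋
    have h5 : (s : ℝ) * α - (⌊(s : ℝ) * α⌋ : ℝ) = Int.fract ((s : ℝ) * α) := rfl
    rw [h5, abs_of_nonneg (Int.fract_nonneg _)] at h4
    have h6 : 0 < φ⁻¹ ^ (s + 1) := pow_pos inv_goldenRatio_pos _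
    rw [abs_of_neg (by linarith)] at h2
    linarith
  · rintro ⟨j, h⟩ i hi his hi2
    obtain ⟨k, hk⟩ : ∃ k, 2 * j + r = k + 1 := ⟨2 * j + r - 1, by omega⟩
    obtain ⟨z, hz⟩ := hfib j
    have hfj := hfract j
    rw [hk] at h hz hfj
    have hlt := inv_goldenRatio_pow_succ_lt k
    rcases h with rfl | rfl
    · rw [hfj]
      refine hlt.trans_le ((best k i hi his ⌊(i : ℝ) * α⌋).trans_eq ?_)
      exact abs_of_nonneg (Int.fract_nonneg _)
    · have hk1 : 2 ≤ k + 1 := by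
        by_contra! hk1
        obtain rfl : k = 0 := by omega
        have : Nat.fib (0 + 1) = 1 := rfl
        omega
      have hs : Int.fract (((2 * Nat.fib (k + 1) : ℕ) : ℝ) * α) = 2 * φ⁻¹ ^ (k + 1) := by
        rw [show ((2 * Nat.fib (k + 1) : ℕ) : ℝ) * α = ((2 * z : ℤ) : ℝ) + 2 * φ⁻¹ ^ (k + 1) by
          push_cast; linear_combination 2 * hz, Int.fract_intCast_add, Int.fract_eq_self]
        exact ⟨by have := pow_pos inv_goldenRatio_pos (k + 1); linarith,
          two_mul_inv_goldenRatio_pow_lt_one hk1⟩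
      rw [hs]
      by_contra! hle
      -- The difference of `i` and `F_{k+1}` is less than `F_{k+1}` and would give too good an
      -- approximation.
      have h0 := Int.fract_nonneg ((i : ℝ) * α)
      have h5 : (i : ℝ) * α - (⌊(i : ℝ) * α⌋ : ℝ) = Int.fract ((i : ℝ) * α) := rfl
      have hb : φ⁻¹ ^ k ≤ |Int.fract ((i : ℝ) * α) - φ⁻¹ ^ (k + 1)| := by
        rcases lt_or_gt_of_ne (show i ≠ Nat.fib (k + 1) by omega) with hlt' | hgt
        · have := best k (Nat.fib (k + 1) - i) (by omega) (by omega) (z - ⌊(i : ℝ) * α⌋)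
          rw [← abs_neg] at this
          convert this using 2
          rw [Nat.cast_sub hlt'.le]
          push_cast
          linear_combination hz - h5
        · have := best k (i - Nat.fib (k + 1)) (by omega) (by omega) (⌊(i : ℝ) * α⌋ - z)
          convert this using 2
          rw [Nat.cast_sub hgt.le]
          push_cast
          linear_combination hz - h5
      have := hb.trans (abs_le.2 ⟨by linarith, by linarith⟩ : _ ≤ φ⁻¹ ^ (k + 1))
      linarith

/-! ### Carries in sums of lower Wythoff numbers -/

/-- The lower Wythoff sequence `⌊n φ⌋`. -/
noncomputable def lower (n : ℕ) : ℕ := ⌊(n : ℝ) * φ⌋₊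

theorem cast_lower (n : ℕ) : (lower n : ℤ) = ⌊(n : ℝ) * φ⌋ :=
  Int.natCast_floor_eq_floor (mul_nonneg n.cast_nonneg Real.goldenRatio_pos.le)

theorem lower_eq_iff {n q : ℕ} : lower n = q ↔ (q : ℝ) ≤ n * φ ∧ (n : ℝ) * φ < q + 1 :=
  Nat.floor_eq_iff (mul_nonneg n.cast_nonneg Real.goldenRatio_pos.le)

theorem lower_le (n : ℕ) : (lower n : ℝ) ≤ n * φ := (lower_eq_iff.1 rfl).1

theorem lt_lower_add_one (n : ℕ) : (n : ℝ) * φ < lower n + 1 := (lower_eq_iff.1 rfl).2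

theorem lower_lt {n : ℕ} (hn : 0 < n) : (lower n : ℝ) < n * φ := by
  refine (lower_le n).lt_of_ne fun h => ?_
  have := Real.goldenRatio_irrational.natCast_mul hn.ne'
  exact this ⟨lower n, by rw [← h]; simp⟩

theorem fract_mul_goldenRatio (n : ℕ) : Int.fract ((n : ℝ) * φ) = n * φ - lower n := by
  rw [Int.fract, ← cast_lower]
  simp

theorem fract_mul_neg_goldenRatio {n : ℕ} (hn : 0 < n) :
    Int.fract ((n : ℝ) * -φ) = lower n + 1 - n * φ := by
  rw [Int.fract_eq_iff]
  exact ⟨by linarith [lt_lower_add_one n], by linarith [lower_lt hn],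
    ⟨-(lower n + 1), by push_cast; ring⟩⟩

theorem lower_add (i j : ℕ) :
    lower (i + j) = lower i + lower j ∨ lower (i + j) = lower i + lower j + 1 := by
  have h1 := lower_le i
  have h2 := lower_le j
  have h3 := lt_lower_add_one i
  have h4 := lt_lower_add_one j
  have h5 := lower_le (i + j)
  have h6 := lt_lower_add_one (i + j)
  push_cast at h5 h6
  have h7 : lower (i + j) < lower i + lower j + 2 := by
    have : (lower (i + j) : ℝ) < (lower i + lower j + 2 : ℕ) := by push_cast; linarith
    exact_mod_cast this
  have h8 : lower i + lower j < lower (i + j) + 1 := by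
    have : ((lower i + lower j : ℕ) : ℝ) < (lower (i + j) + 1 : ℕ) := by push_cast; linarith
    exact_mod_cast this
  omega

/-- The sum of two lower Wythoff numbers carries exactly when the fractional part of the sum is
smaller than that of a summand. -/
theorem lower_add_eq_succ_iff (i j : ℕ) :
    lower (i + j) = lower i + lower j + 1 ↔
      Int.fract (((i + j : ℕ) : ℝ) * φ) < Int.fract ((i : ℝ) * φ) := by
  rw [fract_mul_goldenRatio, fract_mul_goldenRatio]
  have h3 := lt_lower_add_one j
  have h4 := lower_le j
  constructor
  · intro h
    rw [h]
    push_cast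
    linarith
  · intro h
    refine (lower_add i j).resolve_left fun h' => ?_
    rw [h'] at h
    push_cast at h
    linarith

theorem fract_lt_fract_neg_iff {i s : ℕ} (hi : 0 < i) (hs : 0 < s) :
    Int.fract ((s : ℝ) * -φ) < Int.fract ((i : ℝ) * -φ) ↔
      Int.fract ((i : ℝ) * φ) < Int.fract ((s : ℝ) * φ) := by
  rw [fract_mul_neg_goldenRatio hi, fract_mul_neg_goldenRatio hs, fract_mul_goldenRatio,
    fract_mul_goldenRatio]
  constructor <;> intro h <;> linarith

/-- Lower Wythoff numbers always carry in a sum with value `s` exactly for `F_k` and `2 * F_k` with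
`k` odd. -/
theorem always_carry_iff {s : ℕ} (hs : 0 < s) :
    (∀ i j : ℕ, 0 < i → i < j → i + j = s → lower s = lower i + lower j + 1) ↔
      ∃ k : ℕ, Odd k ∧ (s = Nat.fib k ∨ s = 2 * Nat.fib k) := by
  have h1 := fract_record_iff (α := φ) (.inl rfl) (r := 1) (.inl rfl) (fun j => by
    refine ⟨Nat.fib (2 * j + 1 + 1), ?_⟩
    rw [fib_mul_goldenRatio, goldenConj_pow_of_odd ⟨j, rfl⟩]
    push_cast
    ring) hs
  have h2 : (∃ k : ℕ, Odd k ∧ (s = Nat.fib k ∨ s = 2 * Nat.fib k)) ↔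
      ∃ j : ℕ, s = Nat.fib (2 * j + 1) ∨ s = 2 * Nat.fib (2 * j + 1) :=
    ⟨fun ⟨k, ⟨j, hj⟩, h⟩ => ⟨j, hj ▸ h⟩, fun ⟨j, h⟩ => ⟨_, ⟨j, rfl⟩, h⟩⟩
  rw [h2, ← h1]
  constructor
  · intro H i hi his hne
    obtain ⟨j, rfl⟩ := Nat.exists_eq_add_of_lt his
    rw [add_assoc, ← lower_add_eq_succ_iff]
    rcases lt_or_gt_of_ne (show i ≠ j + 1 by omega) with h | h
    · exact H i (j + 1) hi h (by ring)
    · rw [← add_assoc, H (j + 1) i (by omega) h (by ring)]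
      ring
  · rintro H i j hi hij rfl
    exact (lower_add_eq_succ_iff i j).2 (H i hi (by omega) (by omega))

/-- Lower Wythoff numbers never carry in a sum with value `s` exactly for `F_k` and `2 * F_k` with
`k` even. -/
theorem never_carry_iff {s : ℕ} (hs : 0 < s) :
    (∀ i j : ℕ, 0 < i → i < j → i + j = s → lower s = lower i + lower j) ↔
      ∃ k : ℕ, Even k ∧ (s = Nat.fib k ∨ s = 2 * Nat.fib k) := by
  have h1 := fract_record_iff (α := -φ) (.inr rfl) (r := 2) (.inr rfl) (fun j => by
    refine ⟨-Nat.fib (2 * j + 2 + 1), ?_⟩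
    rw [mul_neg, fib_mul_goldenRatio, goldenConj_pow_of_even ⟨j + 1, by ring⟩]
    push_cast
    ring) hs
  have h2 : (∃ k : ℕ, Even k ∧ (s = Nat.fib k ∨ s = 2 * Nat.fib k)) ↔
      ∃ j : ℕ, s = Nat.fib (2 * j + 2) ∨ s = 2 * Nat.fib (2 * j + 2) := by
    refine ⟨fun ⟨k, ⟨j, hj⟩, h⟩ => ?_, fun ⟨j, h⟩ => ⟨_, ⟨j + 1, by ring⟩, h⟩⟩
    rcases j with _ | j
    · subst hj
      simp at h
      omega
    · exact ⟨j, by rwa [show 2 * j + 2 = k by omega]⟩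
  have h3 : ∀ i j : ℕ, 0 < i → 0 < j → (lower (i + j) = lower i + lower j ↔
      Int.fract (((i + j : ℕ) : ℝ) * -φ) < Int.fract ((i : ℝ) * -φ)) := by
    intro i j hi hj
    rw [fract_lt_fract_neg_iff hi (by omega), fract_mul_goldenRatio, fract_mul_goldenRatio]
    have h4 := lower_lt hj
    have h5 := lt_lower_add_one j
    constructor
    · intro h
      rw [h]
      push_cast
      linarith
    · intro h
      refine (lower_add i j).resolve_right fun h' => ?_
      rw [h'] at h
      push_cast at h
      linarith
  rw [h2, ← h1]
  constructor
  · intro H i hi his hne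
    obtain ⟨j, rfl⟩ := Nat.exists_eq_add_of_lt his
    rw [add_assoc, ← h3 _ _ hi (by omega)]
    rcases lt_or_gt_of_ne (show i ≠ j + 1 by omega) with h | h
    · exact H i (j + 1) hi h (by ring)
    · rw [← add_assoc, H (j + 1) i (by omega) h (by ring), add_comm]
  · rintro H i j hi hij rfl
    exact (h3 i j hi (by omega)).2 (H i hi (by omega) (by omega))

theorem goldenRatio_bounds : 8 / 5 < φ ∧ φ < 5 / 3 := by
  have h := Real.goldenRatio_sq
  have h0 := Real.goldenRatio_pos
  constructor <;> by_contra! hc <;> nlinarith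

/-! ### The letters of the Fibonacci word and the upper Wythoff sequence -/

theorem lower_add_fib {n k : ℕ} (hn : 0 < n) (hnk : n < Nat.fib (k + 1)) :
    lower (n + Nat.fib (k + 1)) = lower n + Nat.fib (k + 2) := by
  have h1 := inv_goldenRatio_pow_le_abs hn hnk (lower n : ℤ)
  have h2 := inv_goldenRatio_pow_le_abs hn hnk (lower n + 1 : ℤ)
  have h3 := lower_le n
  have h4 := lt_lower_add_one n
  have h5 := fib_mul_goldenRatio (k + 1)
  have h6 := inv_goldenRatio_pow_succ_lt k
  have h7 := abs_le.1 (abs_goldenConj_pow (k + 1)).le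
  push_cast at h1 h2
  rw [abs_of_nonneg (by linarith)] at h1
  rw [abs_of_neg (by linarith)] at h2
  rw [lower_eq_iff]
  push_cast
  rw [add_mul, h5]
  exact ⟨by linarith, by linarith⟩

theorem lower_add_one (n : ℕ) : lower (n + 1) = lower n + 1 ∨ lower (n + 1) = lower n + 2 := by
  have h : lower 1 = 1 := by
    rw [lower_eq_iff]
    constructor <;> norm_num <;> linarith [goldenRatio_bounds.1, goldenRatio_bounds.2]
  have := lower_add n 1
  omega

theorem fibWord_add_fib {n j : ℕ} (hj : j < Nat.fib (n + 2)) :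
    fibWord (j + Nat.fib (n + 3)) = fibWord j := by
  have h1 : Nat.fib (n + 3) = (fibPrefix (n + 1)).length := (fibPrefix_length (n + 1)).symm
  have h2 : j < (fibPrefix n).length := by rwa [fibPrefix_length]
  have h3 : j + Nat.fib (n + 3) < (fibPrefix (n + 2)).length := by
    rw [fibPrefix_rec, List.length_append]
    omega
  rw [← fibWord_eq h2, ← fibWord_eq h3]
  simp only [fibPrefix_rec, h1]
  rw [List.getElem_append_right (by omega)]
  simp

/-- The Fibonacci word is the difference word of the lower Wythoff sequence. -/
theorem fibWord_eq_b_iff_lower (j : ℕ) :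
    fibWord j = .b ↔ lower (j + 2) = lower (j + 1) + 1 := by
  suffices H : ∀ n j : ℕ, j < Nat.fib (n + 5) →
      (fibWord j = .b ↔ lower (j + 2) = lower (j + 1) + 1) from
    H j j (by have := Nat.le_fib_add_one (j + 5); omega)
  intro n
  induction n with
  | zero =>
    intro j hj
    have hl : lower 1 = 1 ∧ lower 2 = 3 ∧ lower 3 = 4 ∧ lower 4 = 6 ∧ lower 5 = 8 ∧
        lower 6 = 9 := by
      refine ⟨?_, ?_, ?_, ?_, ?_, ?_⟩ <;> rw [lower_eq_iff] <;> constructor <;> push_cast <;>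
        linarith [goldenRatio_bounds.1, goldenRatio_bounds.2]
    obtain ⟨h1, h2, h3, h4, h5, h6⟩ := hl
    have hj' : j < 5 := hj
    interval_cases j <;> simp only [Nat.reduceAdd, h1, h2, h3, h4, h5, h6] <;> decide
  | succ n ih =>
    intro j hj
    rcases Nat.lt_or_ge j (Nat.fib (n + 5)) with h | h
    · exact ih j h
    · obtain ⟨i, rfl⟩ := Nat.exists_eq_add_of_le' h
      have h1 : Nat.fib (n + 1 + 5) = Nat.fib (n + 4) + Nat.fib (n + 5) := Nat.fib_add_two
      have h2 : Nat.fib (n + 5) = Nat.fib (n + 3) + Nat.fib (n + 4) := Nat.fib_add_two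
      have h3 : Nat.fib 3 ≤ Nat.fib (n + 3) := Nat.fib_mono (by omega)
      have h4 : Nat.fib 3 = 2 := rfl
      have e0 : fibWord (i + Nat.fib (n + 5)) = fibWord i := fibWord_add_fib (n := n + 2) (by
        change i < Nat.fib (n + 4)
        omega)
      have e1 : lower (i + 1 + Nat.fib (n + 5)) = lower (i + 1) + Nat.fib (n + 6) :=
        lower_add_fib (by omega) (by change i + 1 < Nat.fib (n + 5); omega)
      have e2 : lower (i + 2 + Nat.fib (n + 5)) = lower (i + 2) + Nat.fib (n + 6) :=
        lower_add_fib (by omega) (by change i + 2 < Nat.fib (n + 5); omega)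
      rw [e0, ih i (by omega), add_right_comm i (Nat.fib (n + 5)) 2,
        add_right_comm i (Nat.fib (n + 5)) 1, e1, e2]
      omega

/-- The upper Wythoff sequence `⌊n φ²⌋`, written as `⌊n φ⌋ + n`. -/
noncomputable def upper (n : ℕ) : ℕ := lower n + n

theorem upper_add_two_le {i j : ℕ} (h : i < j) : upper i + 2 ≤ upper j := by
  have hmono : Monotone lower :=
    monotone_nat_of_le_succ fun n => by have := lower_add_one n; omega
  have h1 := hmono (Nat.succ_le_of_lt h)
  have h2 := lower_add_one i
  rw [Nat.succ_eq_add_one] at h1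
  unfold upper
  omega

theorem upper_eq_iff {k m : ℕ} :
    upper k = m ↔ (m : ℝ) ≤ k * (φ + 1) ∧ (k : ℝ) * (φ + 1) < m + 1 := by
  have h0 : 0 ≤ (k : ℝ) * φ := mul_nonneg k.cast_nonneg Real.goldenRatio_pos.le
  rw [upper, lower, ← Nat.floor_add_natCast h0, Nat.floor_eq_iff (by positivity), mul_add_one]

/-- The letters `b` of the Fibonacci word are at the positions `⌊k φ²⌋`. -/
theorem isUpperWythoff_iff {m : ℕ} : IsUpperWythoff m ↔ ∃ k : ℕ, 0 < k ∧ m = upper k := by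
  have hφ := goldenRatio_bounds
  -- The numbers `2 - φ` and `φ + 1` are inverse to each other.
  have hinv : (2 - φ) * (φ + 1) = 1 := by linear_combination -Real.goldenRatio_sq
  constructor
  · rintro ⟨j, hj, rfl⟩
    rw [fibWord_eq_b_iff_lower] at hj
    have h1 := lower_lt (Nat.succ_pos j)
    have h2 := lt_lower_add_one (j + 2)
    rw [hj] at h2
    push_cast at h1 h2
    have hlt : lower (j + 1) < 2 * (j + 1) := by
      have : (lower (j + 1) : ℝ) < (2 * (j + 1) : ℕ) := by push_cast; nlinarith
      exact_mod_cast this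
    obtain ⟨k, hk⟩ := Nat.exists_eq_add_of_le hlt.le
    refine ⟨k, by omega, (upper_eq_iff.2 ?_).symm⟩
    have hk' : (2 * (j + 1) : ℝ) = lower (j + 1) + k := by exact_mod_cast hk
    have e1 : (j + 1 : ℝ) * (2 - φ) ≤ k := by linarith
    have e2 : (k : ℝ) < (j + 2) * (2 - φ) := by linarith
    have e3 := mul_le_mul_of_nonneg_right e1 (by linarith : 0 ≤ φ + 1)
    have e4 := mul_lt_mul_of_pos_right e2 (by linarith : 0 < φ + 1)
    rw [mul_assoc, hinv] at e3 e4
    push_cast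
    exact ⟨by linarith, by linarith⟩
  · rintro ⟨k, hk, hm⟩
    obtain ⟨j, rfl⟩ : ∃ j, m = j + 1 := ⟨m - 1, by unfold upper at hm; omega⟩
    refine ⟨j, ?_, rfl⟩
    obtain ⟨h1, h2⟩ := upper_eq_iff.1 hm.symm
    push_cast at h1 h2
    obtain ⟨q, hq⟩ : ∃ q, q + k = 2 * (j + 1) := ⟨2 * (j + 1) - k, by unfold upper at hm; omega⟩
    have hq' : (q + k : ℝ) = 2 * (j + 1) := by exact_mod_cast hq
    have e1 := mul_le_mul_of_nonneg_left h1 (by linarith : 0 ≤ 2 - φ)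
    have e2 := mul_lt_mul_of_pos_left h2 (by linarith : 0 < 2 - φ)
    rw [mul_left_comm, hinv] at e1 e2
    rw [fibWord_eq_b_iff_lower,
      lower_eq_iff.2 (⟨by push_cast; linarith, by push_cast; linarith⟩ :
        (q : ℝ) ≤ ((j + 1 : ℕ) : ℝ) * φ ∧ ((j + 1 : ℕ) : ℝ) * φ < q + 1),
      lower_eq_iff.2 (⟨by push_cast; linarith, by push_cast; linarith⟩ :
        ((q + 1 : ℕ) : ℝ) ≤ ((j + 2 : ℕ) : ℝ) * φ ∧ ((j + 2 : ℕ) : ℝ) * φ < (q + 1 : ℕ) + 1)]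

/-! ### Unsums in terms of upper Wythoff numbers -/

/-- The unsums which are an upper Wythoff number `upper s` or one less, given by the numbers
`s = F_k` and `s = 2 * F_k` for which the sums `upper i + upper j` with `i < j` and `i + j = s` all
miss one of the values `upper s` and `upper s - 1`. -/
def IsExceptional (x : ℕ) : Prop :=
  ∃ s k : ℕ, 0 < s ∧ (s = Nat.fib k ∨ s = 2 * Nat.fib k) ∧
    (Odd k ∧ x = upper s ∨ Even k ∧ x + 1 = upper s)

theorem isUnsum_iff {x : ℕ} (hx : 0 < x) :
    IsUnsum x ↔ (¬ IsUpperWythoff x ∧ ¬ IsUpperWythoff (x + 1)) ∨ IsExceptional x := by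
  constructor
  · rintro ⟨-, h⟩
    have hsum : ∀ i j, 0 < i → i < j → x ≠ upper i + upper j := fun i j hi hij he =>
      h ⟨_, _, isUpperWythoff_iff.2 ⟨i, hi, rfl⟩, isUpperWythoff_iff.2 ⟨j, hi.trans hij, rfl⟩,
        by have := upper_add_two_le hij; omega, he⟩
    by_cases h1 : IsUpperWythoff x
    · obtain ⟨s, hs, rfl⟩ := isUpperWythoff_iff.1 h1
      obtain ⟨k, hk, hsk⟩ := (always_carry_iff hs).1 fun i j hi hij he => by
        have := hsum i j hi hij
        have := lower_add i j
        subst he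
        unfold upper at *
        omega
      exact .inr ⟨s, k, hs, hsk, .inl ⟨hk, rfl⟩⟩
    by_cases h2 : IsUpperWythoff (x + 1)
    · obtain ⟨s, hs, hxs⟩ := isUpperWythoff_iff.1 h2
      obtain ⟨k, hk, hsk⟩ := (never_carry_iff hs).1 fun i j hi hij he => by
        have := hsum i j hi hij
        have := lower_add i j
        subst he
        unfold upper at *
        omega
      exact .inr ⟨s, k, hs, hsk, .inr ⟨hk, hxs⟩⟩
    exact .inl ⟨h1, h2⟩
  · refine fun h => ⟨hx, ?_⟩
    rintro ⟨u, v, hu, hv, huv, rfl⟩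
    obtain ⟨i, hi, rfl⟩ := isUpperWythoff_iff.1 hu
    obtain ⟨j, hj, rfl⟩ := isUpperWythoff_iff.1 hv
    have hij : i < j := by
      by_contra! hji
      rcases hji.eq_or_lt with rfl | hji
      · exact huv.false
      · have := upper_add_two_le hji
        omega
    have hadd := lower_add i j
    have hB : IsUpperWythoff (upper (i + j)) := isUpperWythoff_iff.2 ⟨i + j, by omega, rfl⟩
    rcases h with ⟨h1, h2⟩ | ⟨s, k, hs, hsk, ⟨hk, he⟩ | ⟨hk, he⟩⟩
    · have h3 : upper (i + j) = upper i + upper j ∨ upper (i + j) = upper i + upper j + 1 := by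
        unfold upper
        omega
      rcases h3 with h3 | h3
      · exact h1 (h3 ▸ hB)
      · exact h2 (h3 ▸ hB)
    · have h3 := (always_carry_iff hs).2 ⟨k, hk, hsk⟩ i j hi hij
      rcases lt_trichotomy s (i + j) with h | h | h
      · have := upper_add_two_le h
        unfold upper at *
        omega
      · subst h
        have := h3 rfl
        unfold upper at *
        omega
      · have := upper_add_two_le h
        unfold upper at *
        omega
    · have h3 := (never_carry_iff hs).2 ⟨k, hk, hsk⟩ i j hi hij
      rcases lt_trichotomy s (i + j) with h | h | h
      · have := upper_add_two_le h
        unfold upper at *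
        omega
      · subst h
        have := h3 rfl
        unfold upper at *
        omega
      · have := upper_add_two_le h
        unfold upper at *
        omega

theorem lower_fib_of_odd {k : ℕ} (hk : Odd k) : lower (Nat.fib k) = Nat.fib (k + 1) := by
  rw [lower_eq_iff, fib_mul_goldenRatio, goldenConj_pow_of_odd hk]
  have h1 := pow_pos inv_goldenRatio_pos k
  have h2 := inv_goldenRatio_pow_lt_one hk.pos
  exact ⟨by linarith, by linarith⟩

theorem lower_two_mul_fib_of_odd {k : ℕ} (hk : Odd k) (hk2 : 2 ≤ k) :
    lower (2 * Nat.fib k) = 2 * Nat.fib (k + 1) := by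
  rw [lower_eq_iff]
  push_cast
  rw [mul_assoc, fib_mul_goldenRatio, goldenConj_pow_of_odd hk]
  have h1 := pow_pos inv_goldenRatio_pos k
  have h2 := two_mul_inv_goldenRatio_pow_lt_one hk2
  exact ⟨by linarith, by linarith⟩

theorem lower_fib_add_one_of_even {k : ℕ} (hk : Even k) (hk2 : 2 ≤ k) :
    lower (Nat.fib k) + 1 = Nat.fib (k + 1) := by
  obtain ⟨q, hq⟩ : ∃ q, Nat.fib (k + 1) = q + 1 :=
    Nat.exists_eq_succ_of_ne_zero (Nat.fib_pos.2 k.succ_pos).ne'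
  rw [hq, Nat.add_right_cancel_iff, lower_eq_iff, fib_mul_goldenRatio,
    goldenConj_pow_of_even hk, hq]
  have h1 := pow_pos inv_goldenRatio_pos k
  have h2 := inv_goldenRatio_pow_lt_one (k := k) (by omega)
  push_cast
  exact ⟨by linarith, by linarith⟩

theorem lower_two_mul_fib_add_one_of_even {k : ℕ} (hk : Even k) (hk2 : 2 ≤ k) :
    lower (2 * Nat.fib k) + 1 = 2 * Nat.fib (k + 1) := by
  obtain ⟨q, hq⟩ : ∃ q, Nat.fib (k + 1) = q + 1 :=
    Nat.exists_eq_succ_of_ne_zero (Nat.fib_pos.2 k.succ_pos).ne'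
  rw [hq, show 2 * (q + 1) = 2 * q + 1 + 1 by ring, Nat.add_right_cancel_iff, lower_eq_iff]
  push_cast
  rw [mul_assoc, fib_mul_goldenRatio, goldenConj_pow_of_even hk, hq]
  have h1 := pow_pos inv_goldenRatio_pos k
  have h2 := two_mul_inv_goldenRatio_pow_lt_one hk2
  push_cast
  exact ⟨by linarith, by linarith⟩

/-- The exceptional unsums are next to Fibonacci numbers and their doubles. The bound avoids the
small values, where `upper (2 * F_1) = 5` breaks the pattern `upper (2 * F_k) = 2 * F_{k+2}` for
odd `k`. -/
theorem isExceptional_iff {x : ℕ} (hx : 5 < x) : IsExceptional x ↔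
    ∃ k : ℕ, Odd k ∧ (x = Nat.fib k ∨ x = 2 * Nat.fib k) ∨
      Even k ∧ (x + 2 = Nat.fib k ∨ x + 2 = 2 * Nat.fib k) := by
  have h1 : ∀ k, Odd k → upper (Nat.fib k) = Nat.fib (k + 2) := fun k hk => by
    rw [upper, lower_fib_of_odd hk, Nat.fib_add_two, add_comm]
  have h2 : ∀ k, Odd k → 2 ≤ k → upper (2 * Nat.fib k) = 2 * Nat.fib (k + 2) := fun k hk hk2 => by
    rw [upper, lower_two_mul_fib_of_odd hk hk2, Nat.fib_add_two]
    ring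
  have h3 : ∀ k, Even k → 2 ≤ k → upper (Nat.fib k) + 1 = Nat.fib (k + 2) := fun k hk hk2 => by
    rw [upper, add_right_comm, lower_fib_add_one_of_even hk hk2, Nat.fib_add_two, add_comm]
  have h4 : ∀ k, Even k → 2 ≤ k → upper (2 * Nat.fib k) + 1 = 2 * Nat.fib (k + 2) :=
    fun k hk hk2 => by
      rw [upper, add_right_comm, lower_two_mul_fib_add_one_of_even hk hk2, Nat.fib_add_two]
      ring
  constructor
  · rintro ⟨s, k, hs, hsk, ⟨hk, he⟩ | ⟨hk, he⟩⟩
    · refine ⟨k + 2, .inl ⟨by simpa [parity_simps] using hk, ?_⟩⟩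
      rcases hsk with rfl | rfl
      · exact .inl (he.trans (h1 k hk))
      · rcases Nat.eq_or_lt_of_le hk.pos with hk1 | hk1
        · have : upper 1 = 2 := by rw [← Nat.fib_one, h1 1 odd_one]; rfl
          have : upper 2 + 1 = 2 * 3 := h4 2 even_two le_rfl
          obtain rfl : 1 = k := hk1
          simp only [Nat.fib_one, mul_one] at he
          omega
        · exact .inr (he.trans (h2 k hk hk1))
    · have hk2 : 2 ≤ k := by
        rcases hk with ⟨j, rfl⟩
        rcases j with _ | j
        · simp at hsk
          omega
        · omega
      refine ⟨k + 2, .inr ⟨by simpa [parity_simps] using hk, ?_⟩⟩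
      rcases hsk with rfl | rfl
      · exact .inl (by have := h3 k hk hk2; omega)
      · exact .inr (by have := h4 k hk hk2; omega)
  · rintro ⟨k, h⟩
    have hk5 : 5 ≤ k := by
      by_contra! hk5
      have f0 : Nat.fib 0 = 0 := rfl
      have f1 : Nat.fib 1 = 1 := rfl
      have f2 : Nat.fib 2 = 1 := rfl
      have f3 : Nat.fib 3 = 2 := rfl
      have f4 : Nat.fib 4 = 3 := rfl
      rcases h with ⟨hk, h⟩ | ⟨hk, h⟩
      · have hk4 : k ≠ 4 := by rintro rfl; exact absurd hk (by decide)
        interval_cases k <;> omega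
      · interval_cases k <;> omega
    obtain ⟨i, rfl⟩ := Nat.exists_eq_add_of_le' (show 2 ≤ k by omega)
    have hpos : 0 < Nat.fib i := Nat.fib_pos.2 (by omega)
    rcases h with ⟨hk, h⟩ | ⟨hk, h⟩
    · have hi : Odd i := by simpa [parity_simps] using hk
      rcases h with h | h
      · exact ⟨_, i, hpos, .inl rfl, .inl ⟨hi, h.trans (h1 i hi).symm⟩⟩
      · exact ⟨_, i, by omega, .inr rfl, .inl ⟨hi, h.trans (h2 i hi (by omega)).symm⟩⟩
    · have hi : Even i := by simpa [parity_simps] using hk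
      rcases h with h | h
      · exact ⟨_, i, hpos, .inl rfl, .inr ⟨hi, by have := h3 i hi (by omega); omega⟩⟩
      · exact ⟨_, i, by omega, .inr rfl, .inr ⟨hi, by have := h4 i hi (by omega); omega⟩⟩

/-! ### Central words -/

/-- The central words: `centralWord n` is `fibPrefix (n + 1)` without its last two letters. -/
def centralWord : ℕ → List Letter
  | 0 => []
  | 1 => [.a]
  | n + 2 => fibPrefix (n + 2) ++ centralWord n

/-- The last two letters of `fibPrefix (n + 1)`, alternately `ab` and `ba`. -/
def endPair : ℕ → List Letter
  | 0 => [.a, .b]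
  | n + 1 => (endPair n).reverse

theorem endPair_add_two (n : ℕ) : endPair (n + 2) = endPair n := by
  simp only [endPair, List.reverse_reverse]

theorem endPair_of_even {n : ℕ} (hn : Even n) : endPair n = [.a, .b] := by
  obtain ⟨m, rfl⟩ := hn
  induction m with
  | zero => rfl
  | succ m ih => rw [show m + 1 + (m + 1) = m + m + 2 by ring, endPair_add_two, ih]

theorem fibPrefix_eq_centralWord_append (n : ℕ) :
    fibPrefix (n + 1) = centralWord n ++ endPair n := by
  induction n using Nat.twoStepInduction with
  | zero => rfl
  | one => rfl
  | more n ih _ =>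
    rw [fibPrefix_rec, ih, endPair_add_two, centralWord, List.append_assoc]

/-- The second factorization of a central word; with the defining one it shows that central words
are palindromes. -/
theorem centralWord_add_two (n : ℕ) :
    centralWord (n + 2) = fibPrefix (n + 1) ++ centralWord (n + 1) := by
  induction n with
  | zero => rfl
  | succ n ih => rw [centralWord, fibPrefix_rec, List.append_assoc, ← ih]

theorem fibPrefix_append_centralWord (n : ℕ) :
    fibPrefix (n + 2) ++ centralWord n = fibPrefix (n + 1) ++ centralWord (n + 1) :=
  centralWord_add_two n

theorem centralWord_reverse (n : ℕ) : (centralWord n).reverse = centralWord n := by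
  induction n using Nat.twoStepInduction with
  | zero => rfl
  | one => rfl
  | more n ih1 ih2 =>
    rw [centralWord, fibPrefix_eq_centralWord_append]
    simp only [List.reverse_append, ih1, ih2, endPair, List.reverse_reverse]
    rw [← List.append_assoc, ← fibPrefix_eq_centralWord_append, ← fibPrefix_append_centralWord,
      fibPrefix_eq_centralWord_append (n + 1)]
    rfl

theorem fibPrefix_add_four (n : ℕ) :
    fibPrefix (n + 4) = fibPrefix (n + 2) ++ (fibPrefix (n + 1) ++ fibPrefix (n + 2)) := by
  rw [fibPrefix_rec (n + 2), fibPrefix_rec (n + 1), List.append_assoc]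

/-- The passage from the square of `fibPrefix (n + 2)` to that of `fibPrefix (n + 4)` in
terms of central words. For even `n` it is the source of the four blocks `2 W` with the indices
`n + 2`, `n + 2`, `n + 3`, `n + 3`. -/
theorem fibPrefix_square (n : ℕ) :
    fibPrefix (n + 4) ++ fibPrefix (n + 4) =
      fibPrefix (n + 2) ++ fibPrefix (n + 2) ++ centralWord n ++ endPair (n + 1) ++ centralWord n ++
        endPair n ++ centralWord (n + 1) ++ endPair n ++ centralWord (n + 1) ++
          endPair (n + 1) := by
  have h1 : ∀ l, centralWord n ++ (endPair n ++ l) = fibPrefix (n + 1) ++ l := fun l => by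
    rw [fibPrefix_eq_centralWord_append, List.append_assoc]
  have h2 : ∀ l, centralWord (n + 1) ++ (endPair (n + 1) ++ l) = fibPrefix (n + 2) ++ l :=
    fun l => by rw [fibPrefix_eq_centralWord_append, List.append_assoc]
  have h3 : ∀ l, fibPrefix (n + 2) ++ (centralWord n ++ l) =
      fibPrefix (n + 1) ++ (centralWord (n + 1) ++ l) := fun l => by
    rw [← List.append_assoc, fibPrefix_append_centralWord, List.append_assoc]
  have h4 := fibPrefix_eq_centralWord_append (n + 1)
  rw [fibPrefix_add_four]
  simp only [List.append_assoc]
  rw [← h4, h1, h3, h2, ← h3, h1]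

theorem square_prefix (n : ℕ) :
    fibPrefix (n + 2) ++ fibPrefix (n + 2) <+: fibPrefix (n + 4) := by
  refine ⟨centralWord n ++ endPair (n + 1), ?_⟩
  rw [fibPrefix_add_four, List.append_assoc, ← List.append_assoc _ (centralWord n),
    fibPrefix_append_centralWord, List.append_assoc, ← fibPrefix_eq_centralWord_append]

theorem centralWord_length (n : ℕ) : (centralWord n).length + 2 = Nat.fib (n + 3) := by
  have h2 : (endPair n).length = 2 := by
    induction n with
    | zero => rfl
    | succ n ih => rw [endPair, List.length_reverse, ih]
  have h1 := congrArg List.length (fibPrefix_eq_centralWord_append n)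
  rw [fibPrefix_length, List.length_append, h2] at h1
  exact h1.symm

theorem fibPrefix_digit_sum (n : ℕ) :
    ((fibPrefix n).map Letter.digit).sum = Nat.fib (n + 5) := by
  induction n using Nat.twoStepInduction with
  | zero => rfl
  | one => rfl
  | more n ih1 ih2 =>
    rw [fibPrefix_rec, List.map_append, List.sum_append, ih1, ih2, Nat.fib_add_two (n := n + 5),
      add_comm]

theorem centralWord_digit_sum (n : ℕ) :
    ((centralWord n).map Letter.digit).sum + 8 = Nat.fib (n + 6) := by
  have h2 : ((endPair n).map Letter.digit).sum = 8 := by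
    induction n with
    | zero => rfl
    | succ n ih => rw [endPair, List.map_reverse, List.sum_reverse, ih]
  have h1 := fibPrefix_digit_sum (n + 1)
  rw [fibPrefix_eq_centralWord_append, List.map_append, List.sum_append, h2] at h1
  exact h1

theorem centralWord_prefix (n : ℕ) : centralWord n <+: fibPrefix (n + 1) :=
  ⟨endPair n, (fibPrefix_eq_centralWord_append n).symm⟩

/-! ### Gap sequences of sets -/

/-- `w` is the sequence of the first gaps between the members of `U`, from the member `u` on. -/
def GapsFrom (U : ℕ → Prop) : ℕ → List ℕ → Prop
  | u, [] => U u
  | u, g :: w => U u ∧ 0 < g ∧ (∀ x, u < x → x < u + g → ¬ U x) ∧ GapsFrom U (u + g) w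

theorem GapsFrom.mem {U : ℕ → Prop} {u : ℕ} {w : List ℕ} (h : GapsFrom U u w) : U u := by
  cases w with
  | nil => exact h
  | cons g w => exact h.1

theorem gapsFrom_append {U : ℕ → Prop} {u : ℕ} {v w : List ℕ} :
    GapsFrom U u (v ++ w) ↔ GapsFrom U u v ∧ GapsFrom U (u + v.sum) w := by
  induction v generalizing u with
  | nil => exact ⟨fun h => ⟨h.mem, by simpa using h⟩, fun h => by simpa using h.2⟩
  | cons g v ih =>
    simp only [List.cons_append, GapsFrom, ih, List.sum_cons, add_assoc, and_assoc]

/-- The gaps of a set `U` are read off its increasing enumeration. -/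
theorem GapsFrom.eq_map {U : ℕ → Prop} (hU : {x | U x}.Infinite) {k : ℕ} {w : List ℕ}
    (h : GapsFrom U (Nat.nth U k) w) :
    w = (List.range w.length).map fun t => Nat.nth U (k + t + 1) - Nat.nth U (k + t) := by
  induction w generalizing k with
  | nil => rfl
  | cons g w ih =>
    obtain ⟨h1, h2, h3, h4⟩ := h
    have hnth : Nat.nth U (k + 1) = Nat.nth U k + g := by
      apply le_antisymm
      · obtain ⟨j, hj⟩ : Nat.nth U k + g ∈ Set.range (Nat.nth U) := by
          rw [Nat.range_nth_of_infinite hU]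
          exact h4.mem
        rw [← hj]
        have hlt : Nat.nth U k < Nat.nth U j := by omega
        exact (Nat.nth_le_nth hU).2 (Nat.succ_le_of_lt ((Nat.nth_lt_nth hU).1 hlt))
      · by_contra! hlt
        exact h3 _ ((Nat.nth_lt_nth hU).2 k.lt_succ_self) hlt (Nat.nth_mem_of_infinite hU _)
    rw [← hnth] at h4
    have := ih h4
    rw [List.length_cons, List.range_succ_eq_map, List.map_cons, List.map_map]
    congr 1
    · simp [hnth]
    · refine this.trans (List.map_congr_left fun t _ => ?_)
      simp only [Function.comp, Nat.succ_eq_add_one]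
      rw [add_right_comm k 1 t, add_assoc k t 1]

/-! ### Gaps between the occurrences of the factor `aa` -/

/-- The word `w` occurs in the Fibonacci word at position `p`, counted from `0`. -/
def OccursAt : ℕ → List Letter → Prop
  | _, [] => True
  | p, x :: w => fibWord p = x ∧ OccursAt (p + 1) w

theorem occursAt_append {p : ℕ} {v w : List Letter} :
    OccursAt p (v ++ w) ↔ OccursAt p v ∧ OccursAt (p + v.length) w := by
  induction v generalizing p with
  | nil => simp [OccursAt]
  | cons x v ih =>
    simp only [List.cons_append, OccursAt, ih, List.length_cons, and_assoc]
    rw [add_right_comm, add_assoc]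

theorem OccursAt.of_prefix {p : ℕ} {v w : List Letter} (hw : OccursAt p w) (h : v <+: w) :
    OccursAt p v := by
  obtain ⟨t, rfl⟩ := h
  exact (occursAt_append.1 hw).1

theorem occursAt_fibPrefix (n : ℕ) : OccursAt 0 (fibPrefix n) := by
  suffices H : ∀ (w : List Letter) (p : ℕ),
      (∀ t (h : t < w.length), fibWord (p + t) = w[t]) → OccursAt p w from
    H _ 0 fun t h => by rw [zero_add, fibWord_eq]
  intro w
  induction w with
  | nil => exact fun _ _ => trivial
  | cons x w ih =>
    intro p h
    refine ⟨h 0 (Nat.succ_pos _), ih _ fun t ht => ?_⟩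
    rw [add_assoc, add_comm 1]
    exact h (t + 1) (Nat.succ_lt_succ ht)

/-- The return words of `aa` in the Fibonacci word; their lengths are the digits of the letters. -/
def Letter.returnWord : Letter → List Letter
  | .a => [.a, .a, .b, .a, .b]
  | .b => [.a, .a, .b]

/-- The third power of the substitution is conjugate to the coding by the return words of `aa`. -/
theorem substWord_three_append (w : List Letter) :
    substWord (substWord (substWord w)) ++ [.a, .b] =
      [.a, .b] ++ w.flatMap Letter.returnWord := by
  induction w with
  | nil => rfl
  | cons x w ih =>
    rw [← List.singleton_append, substWord_append, substWord_append, substWord_append,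
      List.append_assoc, ih, List.flatMap_append, ← List.append_assoc, ← List.append_assoc]
    congr 1
    cases x <;> rfl

theorem occursAt_returnWords (n : ℕ) :
    OccursAt 2 ((fibPrefix n).flatMap Letter.returnWord) := by
  have h1 : [Letter.a, Letter.b] <+: fibPrefix (n + 2) := fibPrefix_prefix (m := 1) (by omega)
  have h2 : fibPrefix (n + 3) ++ [.a, .b] <+: fibPrefix (n + 4) := by
    rw [fibPrefix_rec (n + 2)]
    exact (List.prefix_append_right_inj _).2 h1
  have h3 := (occursAt_fibPrefix _).of_prefix h2
  rw [fibPrefix_succ, fibPrefix_succ, fibPrefix_succ, substWord_three_append,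
    occursAt_append] at h3
  exact h3.2

/-- The positions, counted from `1`, of the factor `aa` in the Fibonacci word. -/
def IsDoubleA (x : ℕ) : Prop := 0 < x ∧ ¬ IsUpperWythoff x ∧ ¬ IsUpperWythoff (x + 1)

theorem isUpperWythoff_succ (j : ℕ) : IsUpperWythoff (j + 1) ↔ fibWord j = .b :=
  ⟨fun ⟨i, hi, h⟩ => by rwa [Nat.succ_injective h], fun h => ⟨j, h, rfl⟩⟩

theorem gapsFrom_isDoubleA_of_occursAt {p : ℕ} {v : List Letter}
    (h : OccursAt p (v.flatMap Letter.returnWord ++ [.a, .a])) :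
    GapsFrom IsDoubleA (p + 1) (v.map Letter.digit) := by
  have hA : ∀ j, IsDoubleA (j + 1) ↔ fibWord j ≠ .b ∧ fibWord (j + 1) ≠ .b := fun j => by
    simp only [IsDoubleA, isUpperWythoff_succ, Nat.succ_pos, true_and, ne_eq]
  induction v generalizing p with
  | nil =>
    obtain ⟨h1, h2, -⟩ := h
    exact (hA p).2 (by simp [h1, h2])
  | cons x v ih =>
    rw [List.flatMap_cons, List.append_assoc, occursAt_append] at h
    obtain ⟨h, h'⟩ := h
    cases x with
    | a =>
      obtain ⟨h0, h1, h2, h3, h4, -⟩ := h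
      refine ⟨(hA p).2 (by simp [h0, h1]), by decide, fun y hy1 hy2 => ?_, ih h'⟩
      obtain ⟨t, rfl⟩ := Nat.exists_eq_add_of_lt hy1
      rw [hA]
      have ht : t < 4 := by simp [Letter.digit] at hy2; omega
      interval_cases t <;> simp_all
    | b =>
      obtain ⟨h0, h1, h2, -⟩ := h
      refine ⟨(hA p).2 (by simp [h0, h1]), by decide, fun y hy1 hy2 => ?_, ih h'⟩
      obtain ⟨t, rfl⟩ := Nat.exists_eq_add_of_lt hy1
      rw [hA]
      have ht : t < 2 := by simp [Letter.digit] at hy2; omega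
      interval_cases t <;> simp_all

/-- The gaps between the occurrences of `aa` in the Fibonacci word form the Fibonacci word itself,
with the letters `5` and `3`. -/
theorem gapsFrom_isDoubleA {v : List Letter} {n : ℕ} (hv : v <+: fibPrefix n) :
    GapsFrom IsDoubleA 3 (v.map Letter.digit) := by
  have hlt : v.length < (fibPrefix (n + v.length)).length := by
    have := lt_fibPrefix_length v.length
    exact this.trans_le (fibPrefix_prefix (by omega)).length_le
  have hv' := hv.trans (fibPrefix_prefix (Nat.le_add_right n v.length))
  obtain ⟨t, ht⟩ := hv'
  obtain ⟨x, t, rfl⟩ : ∃ x t', t = x :: t' := by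
    cases t with
    | nil => rw [← ht] at hlt; simp at hlt
    | cons x t => exact ⟨x, t, rfl⟩
  refine gapsFrom_isDoubleA_of_occursAt ((occursAt_returnWords (n + v.length)).of_prefix ?_)
  rw [← ht, List.flatMap_append, List.prefix_append_right_inj, List.flatMap_cons]
  cases x
  · exact ⟨[.b, .a, .b] ++ t.flatMap Letter.returnWord, rfl⟩
  · exact ⟨[.b] ++ t.flatMap Letter.returnWord, rfl⟩

/-! ### Splitting of the gaps by exceptional unsums -/

theorem isUnsum_iff_isDoubleA_or {x : ℕ} (hx : 0 < x) :
    IsUnsum x ↔ IsDoubleA x ∨ IsExceptional x := by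
  rw [isUnsum_iff hx, IsDoubleA, and_iff_right hx]

theorem gapsFrom_isUnsum_of_isDoubleA {u : ℕ} {w : List ℕ} (hu : 0 < u)
    (h : GapsFrom IsDoubleA u w) (he : ∀ x, u ≤ x → x ≤ u + w.sum → ¬ IsExceptional x) :
    GapsFrom IsUnsum u w := by
  induction w generalizing u with
  | nil => exact (isUnsum_iff_isDoubleA_or hu).2 (.inl h)
  | cons g w ih =>
    obtain ⟨h1, h2, h3, h4⟩ := h
    rw [List.sum_cons] at he
    refine ⟨(isUnsum_iff_isDoubleA_or hu).2 (.inl h1), h2, fun x hx1 hx2 hx => ?_,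
      ih (by omega) h4 fun x hx1 hx2 => he x (by omega) (by omega)⟩
    rcases (isUnsum_iff_isDoubleA_or (by omega)).1 hx with hx | hx
    · exact h3 x hx1 hx2 hx
    · exact he x (by omega) (by omega) hx

/-- An exceptional unsum splits a gap between occurrences of `aa` into two gaps. -/
theorem gapsFrom_isUnsum_split {u p q : ℕ} (hu : 0 < u) (hp : 0 < p) (hq : 0 < q)
    (h : GapsFrom IsDoubleA u [p + q])
    (he : ∀ x, u ≤ x → x ≤ u + p + q → (IsExceptional x ↔ x = u + p)) :
    GapsFrom IsUnsum u [p, q] := by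
  obtain ⟨h1, -, h3, h4⟩ := h
  refine ⟨(isUnsum_iff_isDoubleA_or hu).2 (.inl h1), hp, fun x hx1 hx2 hx => ?_,
    (isUnsum_iff_isDoubleA_or (by omega)).2 (.inr ((he _ (by omega) (by omega)).2 rfl)), hq,
    fun x hx1 hx2 hx => ?_, (isUnsum_iff_isDoubleA_or (by omega)).2 (.inl ?_)⟩
  · rcases (isUnsum_iff_isDoubleA_or (by omega)).1 hx with hx | hx
    · exact h3 x hx1 (by omega) hx
    · have := (he x (by omega) (by omega)).1 hx
      omega
  · rcases (isUnsum_iff_isDoubleA_or (by omega)).1 hx with hx | hx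
    · exact h3 x (by omega) (by omega) hx
    · have := (he x (by omega) (by omega)).1 hx
      omega
  · rw [add_assoc]
    exact h4

/-- The exceptional unsums between `2 * F_m - 2` and `2 * F_{m+2} - 2`, for odd `m = n + 7`. -/
theorem isExceptional_iff_of_mem_block {n x : ℕ} (hn : Even n)
    (h1 : 2 * Nat.fib (n + 7) ≤ x + 2) (h2 : x + 2 ≤ 2 * Nat.fib (n + 9)) :
    IsExceptional x ↔ x = 2 * Nat.fib (n + 7) ∨ x = Nat.fib (n + 9) ∨
      x + 2 = 2 * Nat.fib (n + 8) ∨ x + 2 = Nat.fib (n + 10) := by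
  have f5 : 5 ≤ Nat.fib (n + 5) := Nat.fib_mono (show 5 ≤ n + 5 by omega)
  have f7 : Nat.fib (n + 7) = Nat.fib (n + 5) + Nat.fib (n + 6) := Nat.fib_add_two
  have f8 : Nat.fib (n + 8) = Nat.fib (n + 6) + Nat.fib (n + 7) := Nat.fib_add_two
  have f9 : Nat.fib (n + 9) = Nat.fib (n + 7) + Nat.fib (n + 8) := Nat.fib_add_two
  have f10 : Nat.fib (n + 10) = Nat.fib (n + 8) + Nat.fib (n + 9) := Nat.fib_add_two
  have f11 : Nat.fib (n + 11) = Nat.fib (n + 9) + Nat.fib (n + 10) := Nat.fib_add_two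
  have hle : ∀ k, k ≤ n + 8 → Nat.fib k ≤ Nat.fib (n + 8) := fun k hk => Nat.fib_mono hk
  have hle' : ∀ k, k ≤ n + 6 → Nat.fib k ≤ Nat.fib (n + 6) := fun k hk => Nat.fib_mono hk
  have hge : ∀ k, n + 11 ≤ k → Nat.fib (n + 11) ≤ Nat.fib k := fun k hk => Nat.fib_mono hk
  have hge' : ∀ k, n + 10 ≤ k → Nat.fib (n + 10) ≤ Nat.fib k := fun k hk => Nat.fib_mono hk
  have hge'' : ∀ k, n + 9 ≤ k → Nat.fib (n + 9) ≤ Nat.fib k := fun k hk => Nat.fib_mono hk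
  rw [isExceptional_iff (by omega)]
  rw [Nat.even_iff] at hn
  constructor
  · rintro ⟨k, ⟨hk, h | h⟩ | ⟨hk, h | h⟩⟩
    · rw [Nat.odd_iff] at hk
      have := hle k
      have := hge k
      obtain rfl : k = n + 9 := by omega
      exact .inr (.inl h)
    · rw [Nat.odd_iff] at hk
      have := hle' k
      have := hge'' k
      obtain rfl : k = n + 7 := by omega
      exact .inl h
    · rw [Nat.even_iff] at hk
      have := hle k
      have := hge k
      obtain rfl : k = n + 10 := by omega
      exact .inr (.inr (.inr h))
    · rw [Nat.even_iff] at hk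
      have := hle' k
      have := hge' k
      obtain rfl : k = n + 8 := by omega
      exact .inr (.inr (.inl h))
  · rintro (h | h | h | h)
    · exact ⟨n + 7, .inl ⟨by rw [Nat.odd_iff]; omega, .inr h⟩⟩
    · exact ⟨n + 9, .inl ⟨by rw [Nat.odd_iff]; omega, .inl h⟩⟩
    · exact ⟨n + 8, .inr ⟨by rw [Nat.even_iff]; omega, .inr h⟩⟩
    · exact ⟨n + 10, .inr ⟨by rw [Nat.even_iff]; omega, .inl h⟩⟩

/-! ### The gap sequence of the unsums -/

/-- The words `W i`: apart from the first one they are central words between two digits `3`. The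
value at `0` is irrelevant. -/
def blockWord : ℕ → List ℕ
  | 0 => []
  | 1 => [3]
  | n + 2 => 3 :: ((centralWord n).map Letter.digit ++ [3])

theorem blockWord_sum (n : ℕ) : (blockWord (n + 1)).sum + 2 = Nat.fib (n + 5) := by
  cases n with
  | zero => rfl
  | succ n =>
    have := centralWord_digit_sum n
    simp only [blockWord, List.sum_cons, List.sum_append, List.sum_nil]
    change _ = Nat.fib (n + 6)
    omega

theorem blockWord_length (n : ℕ) : (blockWord (n + 1)).length = Nat.fib (n + 2) := by
  cases n with
  | zero => rfl
  | succ n =>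
    have := centralWord_length n
    simp only [blockWord, List.length_cons, List.length_append, List.length_map, List.length_nil]
    change _ = Nat.fib (n + 3)
    omega

theorem doubled_sum (n : ℕ) : (doubled blockWord n).sum + 16 = 2 * Nat.fib (n + 6) := by
  induction n with
  | zero => rfl
  | succ n ih =>
    have h1 := blockWord_sum n
    have h2 : Nat.fib (n + 1 + 6) = Nat.fib (n + 5) + Nat.fib (n + 6) := Nat.fib_add_two
    simp only [doubled, List.sum_append, List.sum_cons, List.sum_nil]
    omega

/-- Between two consecutive squares the gaps between occurrences of `aa` and the four exceptional
unsums combine to four blocks. -/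
theorem gapsFrom_isUnsum_block {n : ℕ} (hn : Even n) :
    GapsFrom IsUnsum (2 * Nat.fib (n + 7) - 2)
      (([2] ++ blockWord (n + 2) ++ [2] ++ blockWord (n + 2)) ++
        ([2] ++ blockWord (n + 3) ++ [2] ++ blockWord (n + 3))) := by
  have f5 : 5 ≤ Nat.fib (n + 5) := Nat.fib_mono (show 5 ≤ n + 5 by omega)
  have f7 : Nat.fib (n + 7) = Nat.fib (n + 5) + Nat.fib (n + 6) := Nat.fib_add_two
  have f8 : Nat.fib (n + 8) = Nat.fib (n + 6) + Nat.fib (n + 7) := Nat.fib_add_two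
  have f9 : Nat.fib (n + 9) = Nat.fib (n + 7) + Nat.fib (n + 8) := Nat.fib_add_two
  have f10 : Nat.fib (n + 10) = Nat.fib (n + 8) + Nat.fib (n + 9) := Nat.fib_add_two
  have s1 := centralWord_digit_sum n
  have s2 : ((centralWord (n + 1)).map Letter.digit).sum + 8 = Nat.fib (n + 7) :=
    centralWord_digit_sum (n + 1)
  have s3 : ((fibPrefix (n + 2)).map Letter.digit).sum = Nat.fib (n + 7) :=
    fibPrefix_digit_sum (n + 2)
  have hE := fun x => isExceptional_iff_of_mem_block (x := x) hn
  have hfib : fibPrefix (n + 2) = centralWord (n + 1) ++ [.b] ++ [.a] := by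
    rw [fibPrefix_eq_centralWord_append, endPair, endPair_of_even hn]
    simp
  -- The prefix ends before the last letter of the second square. Its first piece ends before the
  -- last letter of the first square. After it, each piece `[.a]` is a gap that contains an
  -- exceptional unsum, and the other pieces contain none.
  have hpre : (fibPrefix (n + 2) ++ (centralWord (n + 1) ++ [.b])) ++
      ([.a] ++ ((centralWord n ++ [.b]) ++ ([.a] ++ (centralWord n ++ ([.a] ++ (
        ([.b] ++ centralWord (n + 1)) ++ ([.a] ++ ([.b] ++ centralWord (n + 1) ++ [.b])))))))) <+:
      fibPrefix (n + 6) := by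
    refine List.IsPrefix.trans ⟨[.a], ?_⟩ (square_prefix (n + 2))
    rw [fibPrefix_square, endPair, endPair_of_even hn]
    nth_rw 3 [hfib]
    simp
  have h := gapsFrom_isDoubleA hpre
  have hX : ((fibPrefix (n + 2) ++ (centralWord (n + 1) ++ [Letter.b])).map Letter.digit).sum + 5 =
      2 * Nat.fib (n + 7) := by
    simp only [List.map_append, List.sum_append, List.map_cons, List.map_nil, List.sum_cons,
      List.sum_nil, Letter.digit]
    omega
  rw [List.map_append] at h
  replace h := (gapsFrom_append.1 h).2
  simp only [List.map_append, List.map_cons, List.map_nil, Letter.digit] at h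
  simp only [List.map_append, List.map_cons, List.map_nil, Letter.digit] at hX
  simp only [blockWord]
  generalize (centralWord n).map Letter.digit = C at *
  generalize (centralWord (n + 1)).map Letter.digit = C' at *
  generalize (List.map Letter.digit (fibPrefix (n + 2)) ++ (C' ++ [3])).sum = X at *
  obtain ⟨g1, h⟩ := gapsFrom_append.1 h
  obtain ⟨g2, h⟩ := gapsFrom_append.1 h
  obtain ⟨g3, h⟩ := gapsFrom_append.1 h
  obtain ⟨g4, h⟩ := gapsFrom_append.1 h
  obtain ⟨g5, h⟩ := gapsFrom_append.1 h
  obtain ⟨g6, h⟩ := gapsFrom_append.1 h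
  obtain ⟨g7, g8⟩ := gapsFrom_append.1 h
  have key : GapsFrom IsUnsum (3 + X) ([2, 3] ++ ((C ++ [3]) ++ ([2, 3] ++ (C ++ ([3, 2] ++
      (([3] ++ C') ++ ([3, 2] ++ ([3] ++ C' ++ [3])))))))) := by
    refine gapsFrom_append.2 ⟨gapsFrom_isUnsum_split (by omega) (by decide) (by decide) g1
        fun x hx1 hx2 => ?_,
      gapsFrom_append.2 ⟨gapsFrom_isUnsum_of_isDoubleA (by omega) g2 fun x hx1 hx2 => ?_,
      gapsFrom_append.2 ⟨gapsFrom_isUnsum_split (by omega) (by decide) (by decide) g3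
        fun x hx1 hx2 => ?_,
      gapsFrom_append.2 ⟨gapsFrom_isUnsum_of_isDoubleA (by omega) g4 fun x hx1 hx2 => ?_,
      gapsFrom_append.2 ⟨gapsFrom_isUnsum_split (by omega) (by decide) (by decide) g5
        fun x hx1 hx2 => ?_,
      gapsFrom_append.2 ⟨gapsFrom_isUnsum_of_isDoubleA (by omega) g6 fun x hx1 hx2 => ?_,
      gapsFrom_append.2 ⟨gapsFrom_isUnsum_split (by omega) (by decide) (by decide) g7
        fun x hx1 hx2 => ?_,
      gapsFrom_isUnsum_of_isDoubleA (by omega) g8 fun x hx1 hx2 => ?_⟩⟩⟩⟩⟩⟩⟩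
    all_goals
      try simp only [List.sum_append, List.sum_cons, List.sum_nil] at hx1 hx2 ⊢
      rw [hE x (by omega) (by omega)]
      omega
  rw [show 2 * Nat.fib (n + 7) - 2 = 3 + X by omega]
  convert key using 1
  simp

theorem gapsFrom_isUnsum_initial : GapsFrom IsUnsum 1 (irregular ++ doubled blockWord 1) := by
  have hB : ∀ x, x < 25 → (IsUpperWythoff x ↔ x ∈ [2, 5, 7, 10, 13, 15, 18, 20, 23]) := by
    intro x hx
    rcases x with _ | j
    · simp [IsUpperWythoff]
    · have hlen : (fibPrefix 7).length = 34 := by rw [fibPrefix_length]; rfl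
      have hdec : ∀ i < 24, ((fibPrefix 7)[i]? = some Letter.b ↔
          i + 1 ∈ [2, 5, 7, 10, 13, 15, 18, 20, 23]) := by decide
      rw [isUpperWythoff_succ, ← fibWord_eq (n := 7) (by omega), ← hdec j (by omega),
        List.getElem?_eq_getElem (by omega), Option.some_inj]
  have hU : ∀ x, x < 25 → (IsUnsum x ↔
      x ∈ [1, 2, 3, 4, 5, 6, 8, 10, 11, 13, 14, 16, 19, 21, 24]) := by
    intro x hx
    have h1 : IsUnsum x ↔ 0 < x ∧ ∀ u ∈ [2, 5, 7, 10, 13, 15, 18, 20, 23],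
        ∀ v ∈ [2, 5, 7, 10, 13, 15, 18, 20, 23], u < v → x ≠ u + v := by
      refine and_congr_right fun _ => ⟨fun h u hu v hv huv he => ?_, ?_⟩
      · exact h ⟨u, v, (hB u (by omega)).2 hu, (hB v (by omega)).2 hv, huv, he⟩
      · rintro h ⟨u, v, hu, hv, huv, he⟩
        exact h u ((hB u (by omega)).1 hu) v ((hB v (by omega)).1 hv) huv he
    rw [h1]
    clear h1
    revert x
    decide
  change GapsFrom IsUnsum 1 [1, 1, 1, 1, 1, 2, 2, 1, 2, 1, 2, 3, 2, 3]
  simp only [GapsFrom, Nat.reduceAdd]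
  refine ⟨?_, ?_, ?_, ?_, ?_, ?_, ?_, ?_, ?_, ?_, ?_, ?_, ?_, ?_, ?_, ?_, ?_, ?_, ?_, ?_, ?_, ?_,
    ?_, ?_, ?_, ?_, ?_, ?_, ?_, ?_, ?_, ?_, ?_, ?_, ?_, ?_, ?_, ?_, ?_, ?_, ?_, ?_, ?_⟩
  all_goals first
    | decide
    | exact (hU _ (by decide)).2 (by decide)
    | intro x hx1 hx2; rw [hU x (by omega)]; interval_cases x <;> decide

theorem gapsFrom_isUnsum (m : ℕ) :
    GapsFrom IsUnsum 1 (irregular ++ doubled blockWord (2 * m + 1)) := by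
  induction m with
  | zero => exact gapsFrom_isUnsum_initial
  | succ m ih =>
    change GapsFrom IsUnsum 1 (irregular ++ ((doubled blockWord (2 * m + 1) ++ _) ++ _))
    rw [List.append_assoc, ← List.append_assoc irregular]
    refine gapsFrom_append.2 ⟨ih, ?_⟩
    have h1 : (doubled blockWord (2 * m + 1)).sum + 16 = 2 * Nat.fib (2 * m + 7) :=
      doubled_sum (2 * m + 1)
    have h2 : irregular.sum = 13 := rfl
    rw [List.sum_append, show 1 + (irregular.sum + (doubled blockWord (2 * m + 1)).sum) =
      2 * Nat.fib (2 * m + 7) - 2 by omega]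
    exact gapsFrom_isUnsum_block (even_two_mul m)

theorem infinite_setOf_isUnsum : {n : ℕ | IsUnsum n}.Infinite := by
  refine Set.infinite_of_forall_exists_gt fun N => ?_
  have h1 := Nat.le_fib_self (n := 2 * N + 7) (by omega)
  exact ⟨_, (isUnsum_iff_isDoubleA_or (by omega)).2 (.inr ((isExceptional_iff (by omega)).2
    ⟨2 * N + 7, .inl ⟨⟨N + 3, by ring⟩, .inl rfl⟩⟩)), by omega⟩

theorem doubled_prefix (W : ℕ → List ℕ) {m n : ℕ} (h : m ≤ n) : doubled W m <+: doubled W n := by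
  induction n, h using Nat.le_induction with
  | base => exact List.prefix_rfl
  | succ n _ ih => exact ih.trans (List.prefix_append _ _)

theorem isInitialWord_gap (n : ℕ) :
    IsInitialWord (irregular ++ doubled blockWord n) gap := by
  have h0 : Nat.nth IsUnsum 0 = 1 := by
    have hmem := Nat.nth_mem_of_infinite infinite_setOf_isUnsum 0
    refine le_antisymm ?_ hmem.1
    rw [Nat.nth_zero]
    exact Nat.sInf_le gapsFrom_isUnsum_initial.mem
  obtain ⟨t, ht⟩ := doubled_prefix blockWord (show n ≤ 2 * n + 1 by omega)
  have h := gapsFrom_isUnsum n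
  rw [← ht, ← List.append_assoc, gapsFrom_append, ← h0] at h
  have := h.1.eq_map infinite_setOf_isUnsum
  simp only [zero_add] at this
  exact this

/-! ### Properties of the block words -/

theorem mem_blockWord {i d : ℕ} (h : d ∈ blockWord i) : d = 3 ∨ d = 5 := by
  match i, h with
  | 1, h => exact .inl (by simpa [blockWord] using h)
  | n + 2, h =>
    simp only [blockWord, List.mem_cons, List.mem_append, List.mem_map, List.not_mem_nil,
      or_false] at h
    rcases h with h | ⟨x, -, rfl⟩ | h
    · exact .inl h
    · cases x
      · exact .inr rfl
      · exact .inl rfl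
    · exact .inl h

theorem blockWord_palindrome (i : ℕ) : (blockWord i).Palindrome := by
  apply List.Palindrome.of_reverse_eq
  match i with
  | 0 => rfl
  | 1 => rfl
  | n + 2 => simp [blockWord, ← List.map_reverse, centralWord_reverse]

theorem centralWord_prefix_succ {n : ℕ} : centralWord n <+: centralWord (n + 1) := by
  refine List.prefix_of_prefix_length_le
    ((centralWord_prefix n).trans (fibPrefix_prefix (by omega : n + 1 ≤ n + 2)))
    (centralWord_prefix (n + 1)) ?_
  have h1 := centralWord_length n
  have h2 := centralWord_length (n + 1)
  have h3 : Nat.fib (n + 3) ≤ Nat.fib (n + 1 + 3) := Nat.fib_mono (by omega)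
  omega

theorem blockWord_take {n : ℕ} (hn : 3 ≤ n) :
    (blockWord (n + 1)).take (((blockWord (n + 1)).length + 1) / 2) =
      (blockWord n).take (((blockWord (n + 1)).length + 1) / 2) := by
  -- For `n = 3` the common first half includes the last letter of `W 3`.
  rcases hn.eq_or_lt with rfl | hn
  · rfl
  obtain ⟨k, rfl⟩ := Nat.exists_eq_add_of_le' hn
  rw [blockWord_length]
  have p1 : 3 :: (centralWord (k + 2)).map Letter.digit <+: blockWord (k + 4) :=
    (List.prefix_append _ _ : _ <+: (3 :: (centralWord (k + 2)).map Letter.digit) ++ [3])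
  have p2 : 3 :: (centralWord (k + 2)).map Letter.digit <+: blockWord (k + 5) :=
    List.IsPrefix.trans ((List.prefix_cons_inj 3).2 (centralWord_prefix_succ.map _))
      (List.prefix_append _ _ : _ <+: (3 :: (centralWord (k + 3)).map Letter.digit) ++ [3])
  have h1 : (centralWord (k + 2)).length + 2 = Nat.fib (k + 5) := centralWord_length (k + 2)
  have h2 : Nat.fib (k + 6) = Nat.fib (k + 4) + Nat.fib (k + 5) := Nat.fib_add_two
  have h3 : Nat.fib (k + 5) = Nat.fib (k + 3) + Nat.fib (k + 4) := Nat.fib_add_two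
  have h4 : Nat.fib 3 ≤ Nat.fib (k + 3) := Nat.fib_mono (by omega)
  have h5 : Nat.fib 3 = 2 := rfl
  have hlen : (Nat.fib (k + 6) + 1) / 2 ≤
      (3 :: (centralWord (k + 2)).map Letter.digit).length := by
    rw [List.length_cons, List.length_map]
    omega
  obtain ⟨t1, ht1⟩ := p1
  obtain ⟨t2, ht2⟩ := p2
  change (blockWord (k + 5)).take ((Nat.fib (k + 6) + 1) / 2) =
    (blockWord (k + 4)).take ((Nat.fib (k + 6) + 1) / 2)
  rw [← ht1, ← ht2, List.take_append_of_le_length hlen, List.take_append_of_le_length hlen]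

theorem blockWord_tendsto : WordsTendsto blockWord threeFib := by
  intro j
  rw [Filter.eventually_atTop]
  refine ⟨j + 2, fun n hn => ?_⟩
  obtain ⟨k, rfl⟩ := Nat.exists_eq_add_of_le' (show 2 ≤ n by omega)
  rcases j with _ | j
  · rfl
  · have h1 := centralWord_length k
    have h2 := Nat.le_fib_add_one (k + 3)
    have hj : j < (centralWord k).length := by omega
    have hj' : j < (fibPrefix (k + 1)).length := hj.trans_le (centralWord_prefix k).length_le
    rw [blockWord, List.getElem?_cons_succ, List.getElem?_append_left (by simpa using hj),
      List.getElem?_map, List.getElem?_eq_getElem hj, (centralWord_prefix k).getElem hj,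
      fibWord_eq hj']
    rfl

end WythoffUnsums

theorem mainTheorem1 :
    {n : ℕ | WythoffUnsums.IsUnsum n}.Infinite ∧
    ∃ W : ℕ → List ℕ,
      -- the gap sequence is `1111122121 2 W₁ 2 W₁ 2 W₂ 2 W₂ ⋯`
      (∀ n : ℕ, WythoffUnsums.IsInitialWord
        (WythoffUnsums.irregular ++ WythoffUnsums.doubled W n) WythoffUnsums.gap) ∧
      -- the digits `2` are markers: the words between them only have the letters `3` and `5`
      (∀ i : ℕ, 1 ≤ i → ∀ d ∈ W i, d = 3 ∨ d = 5) ∧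
      (∀ i : ℕ, 1 ≤ i → (W i).Palindrome) ∧
      (∀ i : ℕ, 1 ≤ i → (W i).length = Nat.fib (i + 1)) ∧
      (∀ i : ℕ, 1 ≤ i → (W i).sum + 2 = Nat.fib (i + 4)) ∧
      W 1 = [3] ∧ W 2 = [3, 3] ∧ W 3 = [3, 5, 3] ∧
      -- `W (n + 1)` and `W n` have the same first `⌈|W (n + 1)| / 2⌉` letters
      (∀ n : ℕ, 3 ≤ n →
        (W (n + 1)).take (((W (n + 1)).length + 1) / 2) =
          (W n).take (((W (n + 1)).length + 1) / 2)) ∧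
      WythoffUnsums.WordsTendsto W WythoffUnsums.threeFib := by
  open WythoffUnsums in
  refine ⟨infinite_setOf_isUnsum, blockWord, isInitialWord_gap, fun i _ d hd => mem_blockWord hd,
    fun i _ => blockWord_palindrome i, fun i hi => ?_, fun i hi => ?_, rfl, rfl, rfl,
    fun n hn => blockWord_take hn, blockWord_tendsto⟩
  · obtain ⟨k, rfl⟩ := Nat.exists_eq_add_of_le' hi
    exact blockWord_length k
  · obtain ⟨k, rfl⟩ := Nat.exists_eq_add_of_le' hi
    exact blockWord_sum k
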